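/- Let $K$ be a field and let $P$ be a finite partially ordered set. In the polynomial ring $R = K[x_i : i \in P]$ let $$J(P) = \langle x_i x_j : i, j \in P,\ i \not\le j \text{ and } j \not\le i\rangle .$$ For ideals $I, J \subseteq R$ the join is the ideal $$I * J = \bigl(I(\mathbf y) + J(\mathbf z) + \langle x_i - y_i - z_i : i \in P\rangle\bigr) \cap K[\mathbf x]$$ of $R$, where $I(\mathbf y)$ is $I$ with $y_i$ substituted for $x_i$, and similarly for $J(\mathbf z)$. For $r \ge 1$ the $r$-th secant ideal $I^{\{r\}} = I * \cdots * I$ is the $r$-fold join. For $s \ge 1$ the symbolic power is $I^{(s)} = (W^{-1} I^s) \cap R$, where $W$ is the set of elements of $R$ that lie in no minimal prime of $I$. The ideal $I$ is called differentially perfect if for all $r \ge 1$ and $s \ge 1$ $$\bigl(I^{\{r\}}\bigr)^{(s)} = I^{\{r+s-1\}} + \sum_{i=1}^{s-1} \bigl(I^{\{r\}}\bigr)^{(i)} \bigl(I^{\{r\}}\bigr)^{(s-i)} .$$ Theorem. The ideal $J(P)$ is differentially perfect. Moreover, for all $r \ge 1$ and $s \ge 1$, $$\bigl(J(P)^{\{r\}}\bigr)^{(s)}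 = \Bigl\langle \prod_{k=1}^{l} \prod_{i \in A_k} x_i \;:\; l \ge 0,\ A_1, \dots, A_l \text{ antichains of } P \text{ with } |A_k| \ge r+1 \text{ for all } k \text{ and } \sum_{k=1}^{l} (|A_k| - r) = s \Bigr\rangle .$$ -/

import Mathlib

open MvPolynomial

noncomputable section

/-- The multiplicative set of the elements of `R` that lie in no minimal prime of `I`. -/
def minimalPrimesCompl {R : Type*} [CommRing R] (I : Ideal R) : Submonoid R where
  carrier := {g | ∀ p ∈ I.minimalPrimes, g ∉ p}
  one_mem' := fun p hp h => hp.1.1.ne_top ((Ideal.eq_top_iff_one p).2 h)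
  mul_mem' := fun ha hb p hp h =>
    (hp.1.1.mem_or_mem h).elim (ha p hp) (hb p hp)

/-- The `s`-th symbolic power `I^(s) = (W⁻¹ I^s) ∩ R`, where `W` is the complement of the
union of the minimal primes of `I`. -/
def symbolicPower {R : Type*} [CommRing R] (I : Ideal R) (s : ℕ) : Ideal R :=
  ((I ^ s).map (algebraMap R (Localization (minimalPrimesCompl I)))).comap
    (algebraMap R (Localization (minimalPrimesCompl I)))

variable {K : Type*} [Field K] {σ : Type*}

/-- The join `I ∗ J = (I(y) + J(z) + ⟨x_i - y_i - z_i⟩) ∩ K[x]`. The polynomial ring in the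
variables `x, y, z` is indexed by `σ ⊕ σ ⊕ σ`, in this order. -/
def idealJoin (I J : Ideal (MvPolynomial σ K)) : Ideal (MvPolynomial σ K) :=
  (I.map (rename (R := K) (fun i : σ => (Sum.inr (Sum.inl i) : σ ⊕ σ ⊕ σ)))
    ⊔ J.map (rename (R := K) (fun i : σ => (Sum.inr (Sum.inr i) : σ ⊕ σ ⊕ σ)))
    ⊔ Ideal.span (Set.range fun i : σ =>
        (X (Sum.inl i) - X (Sum.inr (Sum.inl i)) - X (Sum.inr (Sum.inr i)) :
          MvPolynomial (σ ⊕ σ ⊕ σ) K))).comap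
    (rename (R := K) (fun i : σ => (Sum.inl i : σ ⊕ σ ⊕ σ)))

/-- The `r`-th secant ideal `I^{r}`, the `r`-fold join `I ∗ ⋯ ∗ I`, for `r ≥ 1`. The empty
join, which is not used below, is the ideal of all variables (the unit of the join). -/
def secantIdeal (I : Ideal (MvPolynomial σ K)) : ℕ → Ideal (MvPolynomial σ K)
  | 0 => Ideal.span (Set.range X)
  | 1 => I
  | r + 2 => idealJoin (secantIdeal I (r + 1)) I

/-- `I` is `r`-differentially perfect: for all `s ≥ 1`, the `s`-th symbolic power of `I^{r}`
is `I^{r+s-1} + ∑_{i=1}^{s-1} (I^{r})^(i) (I^{r})^(s-i)`. -/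
def IsRDifferentiallyPerfect (I : Ideal (MvPolynomial σ K)) (r : ℕ) : Prop :=
  ∀ s : ℕ, 1 ≤ s →
    symbolicPower (secantIdeal I r) s =
      secantIdeal I (r + s - 1) +
        ∑ i ∈ Finset.Ico 1 s,
          symbolicPower (secantIdeal I r) i * symbolicPower (secantIdeal I r) (s - i)

/-- `I` is differentially perfect: `r`-differentially perfect for all `r ≥ 1`. -/
def IsDifferentiallyPerfect (I : Ideal (MvPolynomial σ K)) : Prop :=
  ∀ r : ℕ, 1 ≤ r → IsRDifferentiallyPerfect I r

/-- The ideal `J(P)` generated by the products `x_i x_j` with `i` and `j` incomparable. -/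
def antichainIdeal (K : Type*) [Field K] (P : Type*) [PartialOrder P] :
    Ideal (MvPolynomial P K) :=
  Ideal.span {f | ∃ i j : P, ¬ i ≤ j ∧ ¬ j ≤ i ∧ f = X i * X j}

/-- The squarefree monomial `m_A = ∏_{i ∈ A} x_i`. -/
def squarefreeMonomial (K : Type*) [Field K] {P : Type*} (A : Finset P) : MvPolynomial P K :=
  ∏ i ∈ A, X i

end

/-! `J(P)` is the Stanley–Reisner ideal of the complex of chains of `P`. A join of such ideals
corresponds to unions of faces, so the `r`-th secant ideal is the squarefree monomial ideal whose
faces are the unions `F` of `r` chains (`secantIdeal_antichainIdeal`). It is the intersection of the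
primes generated by the variables outside such an `F`, and its `s`-th symbolic power is the
intersection of the `s`-th powers of these primes (`symbolicPower_chainOutsideIdeal`). Hence `x^m`
lies in it iff every `F` misses `m`-weight at least `s`.

By a weighted Greene duality (`exists_antichains_of_le_weight`), such an `x^m` is divisible by a
product of antichains whose excesses over `r` add up to at least `s`. Conversely, an antichain meets
`F` in at most `r` points, so its monomial has degree at least its excess outside `F`. This gives
the generators. A generator with a single antichain lies in `I^{r+s-1}`, since `r + s` incomparable
points are not covered by `r + s - 1` chains; any other generator splits off one antichain. This
gives differential perfection. -/

/-! ### Duality for the assignment problem -/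

/-- Weighted König–Egerváry duality: an assignment problem with natural costs `c` on the pairs
allowed by `ok` has an integral dual solution that is tight along some allowed permutation. -/
theorem exists_dual_tight_perm {ι : Type*} [Fintype ι] [DecidableEq ι] (c : ι → ι → ℕ)
    (ok : ι → ι → Prop) (hok : ∀ i, ok i i) :
    ∃ u v : ι → ℤ, (∀ i j, ok i j → u i + v j ≤ c i j) ∧
      ∃ τ : Equiv.Perm ι, ∀ i, ok i (τ i) ∧ u i + v (τ i) = c i (τ i) := by
  classical
  let D : ℤ → Prop := fun z => ∃ u v : ι → ℤ, (∀ i j, ok i j → u i + v j ≤ c i j) ∧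
    ∑ i, u i + ∑ i, v i = z
  have hb : ∃ b : ℤ, ∀ z, D z → z ≤ b := by
    refine ⟨∑ i, (c i i : ℤ), ?_⟩
    rintro z ⟨u, v, h, rfl⟩
    rw [← Finset.sum_add_distrib]
    exact Finset.sum_le_sum fun i _ => h i i (hok i)
  have hn : ∃ z, D z := ⟨0, 0, 0, fun i j _ => by simp, by simp⟩
  obtain ⟨z, ⟨u, v, huv, hz⟩, hmax⟩ := Int.exists_greatest_of_bdd hb hn
  refine ⟨u, v, huv, ?_⟩
  let t : ι → Finset ι := fun i => {j | ok i j ∧ u i + v j = c i j}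
  have hall : ∀ s : Finset ι, s.card ≤ (s.biUnion t).card := by
    intro s
    by_contra! hs
    -- If Hall's condition fails at `s`, raise `u` on `s` and lower `v` on its tight neighbours by
    -- 1. Non-tight pairs have integral slack at least 1, so feasibility survives while the dual
    -- value grows.
    have := hmax (∑ i, (u i + if i ∈ s then 1 else 0) +
        ∑ i, (v i - if i ∈ s.biUnion t then 1 else 0)) ⟨_, _, ?_, rfl⟩
    · rw [Finset.sum_add_distrib, Finset.sum_sub_distrib] at this
      simp only [Finset.sum_ite_mem, Finset.univ_inter, Finset.sum_const, nsmul_eq_mul,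
        mul_one] at this
      omega
    · intro i j hij
      have h1 := huv i j hij
      by_cases hi : i ∈ s
      · by_cases hj : j ∈ s.biUnion t
        · simp only [hi, hj, if_true]; linarith
        · have : u i + v j ≠ c i j := fun h => hj
            (Finset.mem_biUnion.2 ⟨i, hi, by simpa [t] using ⟨hij, h⟩⟩)
          simp only [hi, hj, if_true, if_false]
          omega
      · simp only [hi, if_false]
        split_ifs <;> omega
  obtain ⟨f, hf, hft⟩ := (Finset.all_card_le_biUnion_card_iff_exists_injective t).1 hall
  refine ⟨Equiv.ofBijective f (Finite.injective_iff_bijective.1 hf), fun i => ?_⟩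
  simpa [t] using hft i

/-! ### Unions of chains -/

/-- `F` is a union of `r` chains. -/
def IsChainColorable {P : Type*} [PartialOrder P] (r : ℕ) (F : Finset P) : Prop :=
  ∃ g : P → ℕ, (∀ i ∈ F, g i < r) ∧ ∀ i ∈ F, ∀ j ∈ F, g i = g j → i ≤ j ∨ j ≤ i

theorem IsChainColorable.mono {P : Type*} [PartialOrder P] {r : ℕ} {F G : Finset P}
    (h : IsChainColorable r G) (hFG : F ⊆ G) : IsChainColorable r F := by
  obtain ⟨g, h1, h2⟩ := h
  exact ⟨g, fun i hi => h1 i (hFG hi), fun i hi j hj => h2 i (hFG hi) j (hFG hj)⟩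

theorem IsChainColorable.mono_left {P : Type*} [PartialOrder P] {r s : ℕ} {F : Finset P}
    (h : IsChainColorable r F) (hrs : r ≤ s) : IsChainColorable s F := by
  obtain ⟨g, h1, h2⟩ := h
  exact ⟨g, fun i hi => (h1 i hi).trans_le hrs, h2⟩

theorem IsChainColorable.union {P : Type*} [PartialOrder P] [DecidableEq P] {r s : ℕ}
    {F G : Finset P} (hF : IsChainColorable r F) (hG : IsChainColorable s G) :
    IsChainColorable (r + s) (F ∪ G) := by
  obtain ⟨g, h1, h2⟩ := hF
  obtain ⟨g', h1', h2'⟩ := hG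
  refine ⟨fun i => if i ∈ F then g i else r + g' i, fun i hi => ?_, fun i hi j hj hij => ?_⟩
  · by_cases hiF : i ∈ F
    · have := h1 i hiF
      simp only [hiF, if_true]; omega
    · have := h1' i ((Finset.mem_union.1 hi).resolve_left hiF)
      simp only [hiF, if_false]; omega
  · by_cases hiF : i ∈ F <;> by_cases hjF : j ∈ F <;> simp only [hiF, hjF, if_true, if_false] at hij
    · exact h2 i hiF j hjF hij
    · have := h1 i hiF; omega
    · have := h1 j hjF; omega
    · exact h2' i ((Finset.mem_union.1 hi).resolve_left hiF) j
        ((Finset.mem_union.1 hj).resolve_left hjF) (by omega)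

theorem isChainColorable_one {P : Type*} [PartialOrder P] {F : Finset P} :
    IsChainColorable 1 F ↔ ∀ i ∈ F, ∀ j ∈ F, i ≤ j ∨ j ≤ i := by
  refine ⟨fun ⟨g, h1, h2⟩ i hi j hj => h2 i hi j hj ?_, fun h => ⟨0, by simp, ?_⟩⟩
  · have := h1 i hi
    have := h1 j hj
    omega
  · exact fun i hi j hj _ => h i hi j hj

theorem isChainColorable_card {P : Type*} [PartialOrder P] (F : Finset P) :
    IsChainColorable F.card F := by
  classical
  obtain ⟨e⟩ : Nonempty (F ≃ Fin F.card) := ⟨F.equivFin⟩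
  refine ⟨fun i => if h : i ∈ F then e ⟨i, h⟩ else 0, fun i hi => by simp [hi], ?_⟩
  intro i hi j hj h
  simp only [hi, hj, dif_pos, Fin.val_inj, e.injective.eq_iff, Subtype.mk.injEq] at h
  exact Or.inl h.le

theorem isChainColorable_succ_iff {P : Type*} [PartialOrder P] [DecidableEq P] {r : ℕ}
    {F : Finset P} :
    IsChainColorable (r + 1) F ↔
      ∃ G H, IsChainColorable r G ∧ IsChainColorable 1 H ∧ F = G ∪ H := by
  refine ⟨fun ⟨g, h1, h2⟩ => ?_, ?_⟩
  · refine ⟨{i ∈ F | g i < r}, {i ∈ F | ¬ g i < r}, ⟨g, ?_, ?_⟩, ?_, ?_⟩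
    · simp
    · exact fun i hi j hj => h2 i (Finset.mem_filter.1 hi).1 j (Finset.mem_filter.1 hj).1
    · refine isChainColorable_one.2 fun i hi j hj => ?_
      rw [Finset.mem_filter] at hi hj
      have := h1 i hi.1
      have := h1 j hj.1
      exact h2 i hi.1 j hj.1 (by omega)
    · exact (Finset.filter_union_filter_not_eq _ _).symm
  · rintro ⟨G, H, hG, hH, rfl⟩
    exact hG.union hH

theorem IsChainColorable.card_inter_le {P : Type*} [PartialOrder P] [DecidableEq P] {r : ℕ}
    {F A : Finset P} (hF : IsChainColorable r F) (hA : IsAntichain (· ≤ ·) (A : Set P)) :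
    (A ∩ F).card ≤ r := by
  obtain ⟨g, h1, h2⟩ := hF
  rw [← Finset.card_range r]
  refine Finset.card_le_card_of_injOn g (fun i hi => ?_) fun i hi j hj hij => ?_
  · simpa using h1 i (Finset.mem_inter.1 hi).2
  · rw [Finset.mem_coe, Finset.mem_inter] at hi hj
    rcases h2 i hi.2 j hj.2 hij with h | h
    · exact hA.eq hi.1 hj.1 h
    · exact (hA.eq hj.1 hi.1 h).symm

/-! ### Weighted Greene duality -/

/-- The points of `P` moved by a permutation of `P ⊕ Fin r` that never moves a point of `P` down
inside `P` form a union of `r` chains. -/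
theorem isChainColorable_of_perm {P : Type*} [PartialOrder P] [Finite P] {r : ℕ}
    (τ : Equiv.Perm (P ⊕ Fin r)) (hτ : ∀ i j, τ (Sum.inl i) = Sum.inl j → i ≤ j)
    (F : Finset P) (hF : ∀ i ∈ F, τ (Sum.inl i) ≠ Sum.inl i) : IsChainColorable r F := by
  -- By injectivity of `τ`, the image of a moved point is moved if it lies in `P`. So the orbit
  -- climbs strictly in `P` until it enters `Fin r`, at time `n` in slot `k`.
  have key : ∀ i : P, τ (Sum.inl i) ≠ Sum.inl i → ∃ n k : ℕ,
      (∃ hk : k < r, (τ ^ n) (Sum.inl i) = Sum.inr ⟨k, hk⟩) ∧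
      ∀ n' < n, ∀ j, (τ ^ n') (Sum.inl i) = Sum.inl j → i ≤ j := by
    intro i
    induction i using (wellFounded_gt (α := P)).induction with
    | _ i ih =>
      intro hi
      rcases hj : τ (Sum.inl i) with j | k
      · have hij : i < j := lt_of_le_of_ne (hτ i j hj) (by rintro rfl; exact hi hj)
        obtain ⟨n, k, ⟨hk, h1⟩, h2⟩ := ih j hij fun h => hij.ne
          (Sum.inl_injective (τ.injective (hj.trans h.symm)))
        refine ⟨n + 1, k, ⟨hk, by rw [pow_succ, Equiv.Perm.mul_apply, hj, h1]⟩,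
          fun n' hn' j' hj' => ?_⟩
        rcases n' with _ | n'
        · exact (Sum.inl.inj hj').le
        · rw [pow_succ, Equiv.Perm.mul_apply, hj] at hj'
          exact hij.le.trans (h2 n' (by omega) j' hj')
      · refine ⟨1, k, ⟨k.2, by simpa using hj⟩, fun n' hn' j' hj' => ?_⟩
        obtain rfl : n' = 0 := by omega
        exact (Sum.inl.inj hj').le
  choose! n k h1 h2 using key
  have comp : ∀ i ∈ F, ∀ j ∈ F, k i = k j → n i ≤ n j → j ≤ i := by
    intro i hi j hj hk hn
    obtain ⟨hki, hi'⟩ := h1 i (hF i hi)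
    obtain ⟨hkj, hj'⟩ := h1 j (hF j hj)
    have hpos : n i ≠ 0 := fun h => by simp [h] at hi'
    -- Of two points reaching the same slot, the later arrival `j` has passed through `i`; `hpos`
    -- ensures that this happens before the orbit of `j` leaves `P`.
    refine h2 j (hF j hj) (n j - n i) (by omega) i ?_
    apply (τ ^ n i).injective
    rw [hi', ← Equiv.Perm.mul_apply, ← pow_add, Nat.add_sub_cancel' hn, hj']
    simp only [hk]
  refine ⟨k, fun i hi => (h1 i (hF i hi)).1, fun i hi j hj hij => ?_⟩
  rcases le_total (n i) (n j) with h | h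
  · exact Or.inr (comp i hi j hj hij h)
  · exact Or.inl (comp j hj i hi hij.symm h)

/-- The weighted form of Greene's theorem: if every union of `r` chains misses weight at
least `s`, then there are antichains that cover each point at most as often as its weight and
whose excesses over `r` add up to at least `s`. -/
theorem exists_antichains_of_le_weight {P : Type*} [PartialOrder P] [Fintype P] [DecidableEq P]
    {r s : ℕ} (hr : 1 ≤ r) (m : P → ℕ)
    (h : ∀ F : Finset P, IsChainColorable r F → s ≤ ∑ i ∈ Fᶜ, m i) :
    ∃ (T : Finset ℤ) (A : ℤ → Finset P), (∀ t ∈ T, IsAntichain (· ≤ ·) (A t : Set P)) ∧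
      (∀ i, (T.filter fun t => i ∈ A t).card ≤ m i) ∧ s ≤ ∑ t ∈ T, ((A t).card - r) := by
  -- A permutation pays `m i` for each fixed point `i`; its moved points follow chains upwards that
  -- close up through the `r` free slots.
  let c : P ⊕ Fin r → P ⊕ Fin r → ℕ
    | Sum.inl i, Sum.inl j => if i = j then m i else 0
    | _, _ => 0
  let ok : P ⊕ Fin r → P ⊕ Fin r → Prop
    | Sum.inl i, Sum.inl j => i ≤ j
    | _, _ => True
  obtain ⟨u, v, huv, τ, hτ⟩ := exists_dual_tight_perm c ok (by rintro (i | k) <;> simp [ok])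
  have hPP : ∀ i j, i < j → u (Sum.inl i) + v (Sum.inl j) ≤ 0 := fun i j hij => by
    simpa [c, hij.ne] using huv (Sum.inl i) (Sum.inl j) hij.le
  have hP : ∀ i, u (Sum.inl i) + v (Sum.inl i) ≤ m i := fun i => by
    simpa [c] using huv (Sum.inl i) (Sum.inl i) le_rfl
  have hPr : ∀ i k, u (Sum.inl i) + v (Sum.inr k) ≤ 0 := fun i k => by
    simpa [c] using huv (Sum.inl i) (Sum.inr k) trivial
  have hrP : ∀ k i, u (Sum.inr k) + v (Sum.inl i) ≤ 0 := fun k i => by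
    simpa [c] using huv (Sum.inr k) (Sum.inl i) trivial
  have hrr : ∀ k k', u (Sum.inr k) + v (Sum.inr k') ≤ 0 := fun k k' => by
    simpa [c] using huv (Sum.inr k) (Sum.inr k') trivial
  have hF : IsChainColorable r {i : P | τ (Sum.inl i) ≠ Sum.inl i} := by
    refine isChainColorable_of_perm τ (fun i j hij => ?_) _ (by simp)
    have := (hτ (Sum.inl i)).1
    rwa [hij] at this
  -- Tightness equates the dual value with the cost of `τ`, the weight of its fixed points, which is
  -- the weight missed by the chains of moved points.
  have hs : (s : ℤ) ≤ ∑ x, u x + ∑ x, v x := by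
    have h1 : ∑ x, u x + ∑ x, v x = ∑ x, (c x (τ x) : ℤ) := by
      rw [← Equiv.sum_comp τ v, ← Finset.sum_add_distrib]
      exact Finset.sum_congr rfl fun x _ => (hτ x).2
    rw [h1, ← Nat.cast_sum, Nat.cast_le]
    refine (h _ hF).trans ?_
    rw [Fintype.sum_sum_type]
    refine le_trans ?_ (Nat.le_add_right _ _)
    refine (Finset.sum_congr rfl fun i hi => ?_).trans_le
      (Finset.sum_le_univ_sum_of_nonneg fun i => Nat.zero_le _)
    have : τ (Sum.inl i) = Sum.inl i := by simpa using hi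
    simp [this, c]
  have : Nonempty (Fin r) := ⟨⟨0, hr⟩⟩
  obtain ⟨k₁, hk₁⟩ := Finite.exists_max fun k => u (Sum.inr k)
  obtain ⟨k₂, hk₂⟩ := Finite.exists_max fun k => v (Sum.inr k)
  set β := u (Sum.inr k₁)
  set η := v (Sum.inr k₂)
  have hβη : β + η ≤ 0 := hrr k₁ k₂
  have hu : ∑ k, u (Sum.inr k) ≤ r * β := by
    simpa using Finset.sum_le_sum fun k (_ : k ∈ Finset.univ) => hk₁ k
  have hv : ∑ k, v (Sum.inr k) ≤ r * η := by
    simpa using Finset.sum_le_sum fun k (_ : k ∈ Finset.univ) => hk₂ k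
  -- Level sets of the potentials: for `i < j`, `u i ≤ -v j` forbids a common level. The slot
  -- constraints confine all levels to `(β, -η]`, and the loss of `r` per level is covered by the
  -- slots' share `r * (β + η)` of the dual value.
  let A : ℤ → Finset P := fun t => {i | - v (Sum.inl i) < t ∧ t ≤ u (Sum.inl i)}
  have hcard : ∀ i, ((Finset.Ioc β (-η)).filter fun t => i ∈ A t).card
      = (u (Sum.inl i) + v (Sum.inl i)).toNat := fun i => by
    have : ((Finset.Ioc β (-η)).filter fun t => i ∈ A t)
        = Finset.Ioc (- v (Sum.inl i)) (u (Sum.inl i)) := by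
      ext t
      have h1 : u (Sum.inl i) + η ≤ 0 := hPr i k₂
      have h2 : β + v (Sum.inl i) ≤ 0 := hrP k₁ i
      simp only [A, Finset.mem_filter, Finset.mem_Ioc, Finset.mem_univ, true_and]
      constructor
      · exact fun h => h.2
      · exact fun h => ⟨⟨by linarith [h.1], by linarith [h.2]⟩, h⟩
    rw [this, Int.card_Ioc, sub_neg_eq_add]
  refine ⟨Finset.Ioc β (-η), A, fun t _ i hi j hj hij hle => ?_, fun i => ?_, ?_⟩
  · simp only [A, Finset.coe_filter, Finset.mem_univ, true_and, Set.mem_ofPred_eq] at hi hj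
    have := hPP i j (lt_of_le_of_ne hle hij)
    linarith [hi.2, hj.1]
  · rw [hcard]
    have := hP i
    omega
  · have h1 : ∑ t ∈ Finset.Ioc β (-η), (A t).card
        = ∑ i, (u (Sum.inl i) + v (Sum.inl i)).toNat := by
      rw [Finset.sum_congr rfl fun i _ => (hcard i).symm]
      simpa [Finset.bipartiteAbove, Finset.bipartiteBelow] using
        Finset.sum_card_bipartiteAbove_eq_sum_card_bipartiteBelow
          (s := Finset.Ioc β (-η)) (t := Finset.univ) (fun t i => i ∈ A t)
    have h2 : ∑ i, (u (Sum.inl i) + v (Sum.inl i))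
        ≤ ((∑ t ∈ Finset.Ioc β (-η), (A t).card : ℕ) : ℤ) := by
      rw [h1, Nat.cast_sum]
      exact Finset.sum_le_sum fun i _ => Int.self_le_toNat _
    have h3 : ((∑ t ∈ Finset.Ioc β (-η), (A t).card : ℕ) : ℤ)
        ≤ ((∑ t ∈ Finset.Ioc β (-η), ((A t).card - r) : ℕ) : ℤ) + r * (-η - β) := by
      have : (r : ℤ) * (-η - β) = ∑ t ∈ Finset.Ioc β (-η), (r : ℤ) := by
        rw [Finset.sum_const, Int.card_Ioc, nsmul_eq_mul, Int.toNat_of_nonneg (by linarith),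
          mul_comm]
      rw [this, Nat.cast_sum, Nat.cast_sum, ← Finset.sum_add_distrib]
      exact Finset.sum_le_sum fun t _ => by omega
    rw [Fintype.sum_sum_type, Fintype.sum_sum_type] at hs
    rw [Finset.sum_add_distrib] at h2
    have : (s : ℤ) ≤ ((∑ t ∈ Finset.Ioc β (-η), ((A t).card - r) : ℕ) : ℤ) := by
      linarith
    exact_mod_cast this

/-! ### Monomials and powers of primes generated by variables -/

section

variable {K : Type*} [Field K] {P : Type*}

/-- Every monomial is divisible by the product of the variables in its support. -/
theorem squarefreeMonomial_dvd_monomial {S : Finset P} {m : P →₀ ℕ} (hS : S ⊆ m.support) :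
    squarefreeMonomial K S ∣ monomial m (1 : K) := by
  rw [monomial_eq, C_1, one_mul, squarefreeMonomial, Finsupp.prod]
  refine (Finset.prod_dvd_prod_of_subset _ _ _ hS).trans (Finset.prod_dvd_prod_of_dvd _ _ ?_)
  exact fun i hi => dvd_pow_self _ (Finsupp.mem_support_iff.1 hi)

/-- An ideal contains a polynomial once it contains all its monomials. -/
theorem mem_of_monomial_mem {I : Ideal (MvPolynomial P K)} {f : MvPolynomial P K}
    (h : ∀ m ∈ f.support, monomial m (1 : K) ∈ I) : f ∈ I := by
  rw [f.as_sum]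
  refine Ideal.sum_mem _ fun m hm => ?_
  rw [← mul_one (coeff m f), ← C_mul_monomial]
  exact I.mul_mem_left _ (h m hm)

theorem squarefreeMonomial_eq_monomial (S : Finset P) :
    squarefreeMonomial K S = monomial (Finsupp.indicator S fun _ _ => 1) (1 : K) := by
  rw [monomial_eq, C_1, one_mul, Finsupp.prod_indicator_index _ (by simp), squarefreeMonomial]
  simp

end

/-- The ideal of the polynomials all of whose monomials have degree at least `s` in the variables
outside `F`, that is, the `s`-th power of the ideal generated by these variables. -/
noncomputable def outsideIdeal (K : Type*) [Field K] {P : Type*} [DecidableEq P] (F : Finset P)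
    (s : ℕ) : Ideal (MvPolynomial P K) where
  carrier := {f | (s : ℕ∞) ≤ (f : MvPowerSeries P K).weightedOrder fun i => if i ∈ F then 0 else 1}
  zero_mem' := by simp
  add_mem' {f g} hf hg := by
    rw [Set.mem_ofPred_eq, MvPolynomial.coe_add]
    exact (le_min hf hg).trans (MvPowerSeries.min_weightedOrder_le_add _)
  smul_mem' c f hf := by
    rw [Set.mem_ofPred_eq, smul_eq_mul, MvPolynomial.coe_mul, MvPowerSeries.weightedOrder_mul]
    exact le_add_left hf

section

variable {K : Type*} [Field K] {P : Type*} [DecidableEq P]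

theorem mem_outsideIdeal_iff_order {F : Finset P} {s : ℕ} {f : MvPolynomial P K} :
    f ∈ outsideIdeal K F s ↔ (s : ℕ∞) ≤
      (f : MvPowerSeries P K).weightedOrder fun i => if i ∈ F then 0 else 1 := Iff.rfl

theorem mem_outsideIdeal [Fintype P] {F : Finset P} {s : ℕ} {f : MvPolynomial P K} :
    f ∈ outsideIdeal K F s ↔ ∀ m ∈ f.support, s ≤ ∑ i ∈ Fᶜ, m i := by
  have hw : ∀ m : P →₀ ℕ, Finsupp.weight (fun i => if i ∈ F then 0 else 1) m = ∑ i ∈ Fᶜ, m i := by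
    intro m
    rw [Finsupp.weight_apply, Finsupp.sum_fintype _ _ (by simp)]
    simp only [smul_eq_mul, mul_ite, mul_zero, mul_one]
    rw [← Finset.sum_filter_add_sum_filter_not Finset.univ (· ∈ F), Finset.sum_ite_of_true (by simp),
      Finset.sum_ite_of_false (by simp), Finset.sum_const_zero, zero_add]
    exact Finset.sum_congr (by ext; simp) fun _ _ => rfl
  rw [mem_outsideIdeal_iff_order]
  constructor
  · intro h m hm
    rw [← hw, ← Nat.cast_le (α := ℕ∞)]
    exact h.trans (MvPowerSeries.weightedOrder_le _ (by simpa using hm))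
  · intro h
    refine MvPowerSeries.nat_le_weightedOrder _ fun m hm => ?_
    by_contra hne
    have := h m (by simpa using hne)
    rw [hw] at hm
    omega

theorem mul_mem_outsideIdeal {F : Finset P} {s t : ℕ} {f g : MvPolynomial P K}
    (hf : f ∈ outsideIdeal K F s) (hg : g ∈ outsideIdeal K F t) :
    f * g ∈ outsideIdeal K F (s + t) := by
  rw [mem_outsideIdeal_iff_order] at *
  rw [MvPolynomial.coe_mul, MvPowerSeries.weightedOrder_mul, Nat.cast_add]
  exact add_le_add hf hg

/-- Over a field the weighted order is additive on products, and `f` has order 0. -/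
theorem mem_outsideIdeal_of_mul_mem {F : Finset P} {s : ℕ} {f g : MvPolynomial P K}
    (h : f * g ∈ outsideIdeal K F s) (hf : f ∉ outsideIdeal K F 1) :
    g ∈ outsideIdeal K F s := by
  rw [mem_outsideIdeal_iff_order] at *
  rw [not_le, Nat.cast_one, Order.lt_one_iff] at hf
  rwa [MvPolynomial.coe_mul, MvPowerSeries.weightedOrder_mul, hf, zero_add] at h

theorem outsideIdeal_zero (F : Finset P) : outsideIdeal K F 0 = ⊤ := by
  rw [Ideal.eq_top_iff_one, mem_outsideIdeal_iff_order]
  simp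

theorem isPrime_outsideIdeal (F : Finset P) : (outsideIdeal K F 1).IsPrime where
  ne_top' h := by
    rw [Ideal.eq_top_iff_one, mem_outsideIdeal_iff_order] at h
    simp [MvPowerSeries.weightedOrder_one] at h
  mem_or_mem' {_ _} h := or_iff_not_imp_left.2 (mem_outsideIdeal_of_mul_mem h)

theorem X_mem_outsideIdeal [Fintype P] {F : Finset P} {i : P} :
    (X i : MvPolynomial P K) ∈ outsideIdeal K F 1 ↔ i ∉ F := by
  rw [mem_outsideIdeal, support_X]
  simp [Finsupp.single_apply, Nat.one_le_iff_ne_zero]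

theorem outsideIdeal_one_eq_span [Fintype P] (F : Finset P) :
    outsideIdeal K F 1 = Ideal.span (X '' {i | i ∉ F}) := by
  ext f
  rw [mem_outsideIdeal, mem_ideal_span_X_image]
  refine forall₂_congr fun m _ => ?_
  simp [Nat.one_le_iff_ne_zero]

theorem squarefreeMonomial_mem_outsideIdeal [Fintype P] {F S : Finset P} {s : ℕ} :
    squarefreeMonomial K S ∈ outsideIdeal K F s ↔ s ≤ (S \ F).card := by
  classical
  rw [mem_outsideIdeal, squarefreeMonomial_eq_monomial, support_monomial, if_neg one_ne_zero]
  have : ∑ i ∈ Fᶜ, (Finsupp.indicator S fun _ _ => 1 : P →₀ ℕ) i = (S \ F).card := by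
    simp only [Finsupp.indicator_apply, dite_eq_ite]
    rw [← Finset.sum_filter, Finset.sum_const, smul_eq_mul, mul_one]
    congr 1
    ext i
    simp [and_comm]
  simp only [Finset.mem_singleton, forall_eq, this]

theorem pow_le_outsideIdeal {F : Finset P} {I : Ideal (MvPolynomial P K)}
    (hI : I ≤ outsideIdeal K F 1) (s : ℕ) : I ^ s ≤ outsideIdeal K F s := by
  induction s with
  | zero => simp [outsideIdeal_zero]
  | succ s ih =>
    rw [pow_succ, Ideal.mul_le]
    exact fun f hf g hg => mul_mem_outsideIdeal (ih hf) (hI hg)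

end

/-! ### Secant ideals -/

section

variable (K : Type*) [Field K] {P : Type*} [DecidableEq P]

/-- The polynomials that lie in the `s`-th power of each of the ideals generated by the
variables outside of a union of `r` chains. -/
noncomputable def chainOutsideIdeal (P : Type*) [DecidableEq P] [PartialOrder P] (r s : ℕ) :
    Ideal (MvPolynomial P K) :=
  ⨅ (F : Finset P) (_ : IsChainColorable r F), outsideIdeal K F s

variable {K} [PartialOrder P]

theorem mem_chainOutsideIdeal {r s : ℕ} {f : MvPolynomial P K} :
    f ∈ chainOutsideIdeal K P r s ↔
      ∀ F : Finset P, IsChainColorable r F → f ∈ outsideIdeal K F s := by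
  simp [chainOutsideIdeal]

theorem chainOutsideIdeal_le {r : ℕ} (s : ℕ) {F : Finset P} (hF : IsChainColorable r F) :
    chainOutsideIdeal K P r s ≤ outsideIdeal K F s := iInf₂_le F hF

theorem mul_mem_chainOutsideIdeal {r s t : ℕ} {f g : MvPolynomial P K}
    (hf : f ∈ chainOutsideIdeal K P r s) (hg : g ∈ chainOutsideIdeal K P r t) :
    f * g ∈ chainOutsideIdeal K P r (s + t) :=
  mem_chainOutsideIdeal.2 fun F hF => mul_mem_outsideIdeal
    (mem_chainOutsideIdeal.1 hf F hF) (mem_chainOutsideIdeal.1 hg F hF)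

variable [Fintype P]

theorem mem_chainOutsideIdeal_iff_support {r s : ℕ} {f : MvPolynomial P K} :
    f ∈ chainOutsideIdeal K P r s ↔
      ∀ m ∈ f.support, ∀ F : Finset P, IsChainColorable r F → s ≤ ∑ i ∈ Fᶜ, m i := by
  simp only [mem_chainOutsideIdeal, mem_outsideIdeal]
  tauto

theorem mem_chainOutsideIdeal_one {r : ℕ} {f : MvPolynomial P K} :
    f ∈ chainOutsideIdeal K P r 1 ↔ ∀ m ∈ f.support, ¬ IsChainColorable r m.support := by
  rw [mem_chainOutsideIdeal_iff_support]
  refine forall₂_congr fun m _ => ⟨fun h hm => ?_, fun h F hF => ?_⟩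
  · have := h _ hm
    rw [Finset.sum_eq_zero (fun i hi => by simpa using hi)] at this
    omega
  · rw [Nat.one_le_iff_ne_zero]
    intro h0
    refine h (hF.mono fun i hi => ?_)
    by_contra hiF
    rw [Finset.sum_eq_zero_iff] at h0
    exact Finsupp.mem_support_iff.1 hi (h0 i (Finset.mem_compl.2 hiF))

theorem squarefreeMonomial_mem_chainOutsideIdeal_one {r : ℕ} {S : Finset P}
    (hS : ¬ IsChainColorable r S) : squarefreeMonomial K S ∈ chainOutsideIdeal K P r 1 := by
  refine mem_chainOutsideIdeal.2 fun F hF => squarefreeMonomial_mem_outsideIdeal.2 ?_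
  rw [Nat.one_le_iff_ne_zero, Ne, Finset.card_eq_zero, Finset.sdiff_eq_empty_iff_subset]
  exact fun h => hS (hF.mono h)

theorem antichainIdeal_eq : antichainIdeal K P = chainOutsideIdeal K P 1 1 := by
  apply le_antisymm
  · rw [antichainIdeal, Ideal.span_le]
    rintro _ ⟨i, j, hij, hji, rfl⟩
    have hne : i ≠ j := fun h => hij h.le
    rw [← Finset.prod_pair (f := fun i => (X i : MvPolynomial P K)) hne]
    refine squarefreeMonomial_mem_chainOutsideIdeal_one fun h => ?_
    exact (isChainColorable_one.1 h i (by simp) j (by simp)).elim hij hji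
  · intro f hf
    refine mem_of_monomial_mem fun m hm => ?_
    have := mem_chainOutsideIdeal_one.1 hf m hm
    rw [isChainColorable_one] at this
    push Not at this
    obtain ⟨i, hi, j, hj, hij, hji⟩ := this
    have hne : i ≠ j := fun h => hij h.le
    refine Ideal.mem_of_dvd _ (squarefreeMonomial_dvd_monomial
      (S := {i, j}) (by simp [Finset.insert_subset_iff] at *; exact ⟨hi, hj⟩)) ?_
    exact Ideal.subset_span ⟨i, j, hij, hji, Finset.prod_pair hne⟩

theorem idealJoin_chainOutsideIdeal (r : ℕ) :
    idealJoin (chainOutsideIdeal K P r 1) (chainOutsideIdeal K P 1 1)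
      = chainOutsideIdeal K P (r + 1) 1 := by
  apply le_antisymm
  · intro f hf
    refine mem_chainOutsideIdeal.2 fun H hH => ?_
    obtain ⟨F, G, hF, hG, rfl⟩ := isChainColorable_succ_iff.1 hH
    -- Making the two pieces disjoint lets each `x_i` with `i ∈ F ∪ G` go to exactly one of `y_i`,
    -- `z_i`, so that `ψ` respects `x_i = y_i + z_i`.
    have hG' : IsChainColorable 1 (G \ F) := hG.mono Finset.sdiff_subset
    let q := Ideal.Quotient.mkₐ K (outsideIdeal K (F ∪ G) 1)
    let ψ : MvPolynomial (P ⊕ P ⊕ P) K →ₐ[K] MvPolynomial P K ⧸ outsideIdeal K (F ∪ G) 1 :=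
      aeval (Sum.elim (fun i => q (X i)) (Sum.elim (fun i => if i ∈ F then q (X i) else 0)
        (fun i => if i ∈ G \ F then q (X i) else 0)))
    have hkill : ∀ (S : Finset P) (g : MvPolynomial P K), g ∈ outsideIdeal K S 1 →
        aeval (fun i => if i ∈ S then q (X i) else 0) g = 0 := by
      intro S g hg
      rw [outsideIdeal_one_eq_span] at hg
      suffices Ideal.span (X '' {i | i ∉ S}) ≤
        RingHom.ker (aeval (R := K) (fun i => if i ∈ S then q (X i) else 0)) from this hg
      rw [Ideal.span_le]
      rintro _ ⟨i, hi, rfl⟩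
      simpa using fun h => absurd h hi
    have hq : ∀ g, ψ (rename Sum.inl g) = q g := by
      intro g
      rw [aeval_rename]
      have : aeval (fun i => q (X i)) = q := by ext; simp
      exact DFunLike.congr_fun this g
    rw [idealJoin, Ideal.mem_comap] at hf
    have : ψ (rename Sum.inl f) = 0 := by
      refine (?_ : _ ≤ RingHom.ker ψ) hf
      refine sup_le (sup_le ?_ ?_) ?_
      · rw [Ideal.map_le_iff_le_comap]
        intro g hg
        simpa [aeval_rename, Function.comp_def, ψ] using hkill F g (chainOutsideIdeal_le 1 hF hg)
      · rw [Ideal.map_le_iff_le_comap]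
        intro g hg
        simpa [aeval_rename, Function.comp_def, ψ] using
          hkill (G \ F) g (chainOutsideIdeal_le 1 hG' hg)
      · rw [Ideal.span_le]
        rintro _ ⟨i, rfl⟩
        by_cases hiF : i ∈ F
        · simp [ψ, hiF]
        · by_cases hiG : i ∈ G
          · simp [ψ, hiF, hiG]
          · have : q (X i) = 0 := by
              simpa [q, Ideal.Quotient.eq_zero_iff_mem] using X_mem_outsideIdeal.2 (by simp [*])
            simp [ψ, hiF, hiG, this]
    rw [hq] at this
    exact Ideal.Quotient.eq_zero_iff_mem.1 this
  · intro f hf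
    refine mem_of_monomial_mem fun m hm => ?_
    have hS := mem_chainOutsideIdeal_one.1 hf m hm
    set S := m.support
    refine Ideal.mem_of_dvd _ (squarefreeMonomial_dvd_monomial (subset_refl S)) ?_
    rw [idealJoin, Ideal.mem_comap]
    set I := Ideal.map (rename (R := K) fun i : P => (Sum.inr (Sum.inl i) : P ⊕ P ⊕ P))
      (chainOutsideIdeal K P r 1)
    set J := Ideal.map (rename (R := K) fun i : P => (Sum.inr (Sum.inr i) : P ⊕ P ⊕ P))
      (chainOutsideIdeal K P 1 1)
    set L := Ideal.span (Set.range fun i : P =>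
        (X (Sum.inl i) - X (Sum.inr (Sum.inl i)) - X (Sum.inr (Sum.inr i)) :
          MvPolynomial (P ⊕ P ⊕ P) K))
    rw [← Ideal.Quotient.eq_zero_iff_mem, squarefreeMonomial, map_prod, map_prod]
    have hx : ∀ i ∈ S, Ideal.Quotient.mk (I ⊔ J ⊔ L) (rename Sum.inl (X i : MvPolynomial P K)) =
        Ideal.Quotient.mk (I ⊔ J ⊔ L) (X (Sum.inr (Sum.inl i)) + X (Sum.inr (Sum.inr i))) := by
      intro i _
      rw [Ideal.Quotient.eq, rename_X, ← sub_sub]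
      exact Ideal.mem_sup_right (Ideal.subset_span ⟨i, rfl⟩)
    -- Expand `∏ (y_i + z_i)` over `S`: in each term, either `T` is not a union of `r` chains or `S
    -- \ T` is not a chain.
    rw [Finset.prod_congr rfl hx, ← map_prod, Ideal.Quotient.eq_zero_iff_mem, Finset.prod_add]
    refine Ideal.sum_mem _ fun T hT => ?_
    by_cases hTr : IsChainColorable r T
    · refine Ideal.mul_mem_left _ _ (Ideal.mem_sup_left (Ideal.mem_sup_right ?_))
      have : ¬ IsChainColorable 1 (S \ T) := fun h => hS <|
        isChainColorable_succ_iff.2 ⟨T, S \ T, hTr, h,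
          (Finset.union_sdiff_of_subset (Finset.mem_powerset.1 hT)).symm⟩
      have := Ideal.mem_map_of_mem (rename (R := K) fun i : P => (Sum.inr (Sum.inr i) : P ⊕ P ⊕ P))
        (squarefreeMonomial_mem_chainOutsideIdeal_one (K := K) this)
      simpa [squarefreeMonomial, map_prod] using this
    · refine Ideal.mul_mem_right _ _ (Ideal.mem_sup_left (Ideal.mem_sup_left ?_))
      have := Ideal.mem_map_of_mem (rename (R := K) fun i : P => (Sum.inr (Sum.inl i) : P ⊕ P ⊕ P))
        (squarefreeMonomial_mem_chainOutsideIdeal_one (K := K) hTr)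
      simpa [squarefreeMonomial, map_prod] using this

theorem secantIdeal_antichainIdeal {r : ℕ} (hr : 1 ≤ r) :
    secantIdeal (antichainIdeal K P) r = chainOutsideIdeal K P r 1 := by
  induction r, hr using Nat.le_induction with
  | base => exact antichainIdeal_eq
  | succ r hr ih =>
    obtain ⟨r, rfl⟩ := Nat.exists_eq_add_of_le' hr
    rw [secantIdeal, ih, antichainIdeal_eq, idealJoin_chainOutsideIdeal]

end

/-! ### Symbolic powers -/

section

variable {R : Type*} [CommRing R] {I : Ideal R} {s : ℕ} {f : R}

theorem mem_symbolicPower :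
    f ∈ symbolicPower I s ↔ ∃ w ∈ minimalPrimesCompl I, w * f ∈ I ^ s :=
  IsLocalization.algebraMap_mem_map_algebraMap_iff (minimalPrimesCompl I) _ _ _

/-- Membership in a symbolic power can be tested at each minimal prime separately. -/
theorem mem_symbolicPower_of_forall_minimalPrimes [IsNoetherianRing R]
    (h : ∀ p ∈ I.minimalPrimes, ∃ w ∉ p, w * f ∈ I ^ s) : f ∈ symbolicPower I s := by
  rw [mem_symbolicPower]
  by_contra! hf
  have hfin := Ideal.finite_minimalPrimes_of_isNoetherianRing R I
  -- The colon ideal of `I ^ s` by `f`. By prime avoidance, if it lies in the union of the minimal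
  -- primes, it lies in one of them.
  let Q : Ideal R := Submodule.comap (LinearMap.mulRight R f) (I ^ s)
  have hQ : (Q : Set R) ⊆ ⋃ p ∈ (hfin.toFinset : Set (Ideal R)), (p : Set R) := by
    intro w hw
    by_contra hwp
    refine hf w (fun p hp hwp' => hwp ?_) hw
    exact Set.mem_biUnion (by simpa using hp) hwp'
  rw [Ideal.subset_union_prime ⊥ ⊥ fun p hp _ _ => (hfin.mem_toFinset.1 hp).1.1] at hQ
  obtain ⟨p, hp, hQp⟩ := hQ
  obtain ⟨w, hw, hwf⟩ := h p (hfin.mem_toFinset.1 hp)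
  exact hw (hQp hwf)

end

section

variable {K : Type*} [Field K] {P : Type*} [DecidableEq P] [Fintype P]

theorem outsideIdeal_anti {F G : Finset P} (h : F ⊆ G) (s : ℕ) :
    outsideIdeal K G s ≤ outsideIdeal K F s := by
  intro f hf
  rw [mem_outsideIdeal] at *
  exact fun m hm => (hf m hm).trans
    (Finset.sum_le_sum_of_subset (Finset.compl_subset_compl.2 h))

theorem outsideIdeal_one_le_iff {F : Finset P} {I : Ideal (MvPolynomial P K)} :
    outsideIdeal K F 1 ≤ I ↔ ∀ i ∉ F, X i ∈ I := by
  rw [outsideIdeal_one_eq_span, Ideal.span_le, Set.image_subset_iff]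
  rfl

variable [PartialOrder P]

theorem exists_X_mem_of_not_isChainColorable {r : ℕ} {p : Ideal (MvPolynomial P K)}
    (hp : p.IsPrime) (hle : chainOutsideIdeal K P r 1 ≤ p) {S : Finset P}
    (hS : ¬ IsChainColorable r S) : ∃ i ∈ S, X i ∈ p :=
  hp.prod_mem_iff.1 (hle (squarefreeMonomial_mem_chainOutsideIdeal_one hS))

/-- Adding `i ∉ F` to a maximal `F` gives a nonface, so a prime `q` over the ideal contains one of
its variables; if `q` lies below the prime of `F`, this variable can only be `x_i`. -/
theorem mem_minimalPrimes_of_maximal {r : ℕ} {F : Finset P}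
    (hF : Maximal (IsChainColorable r) F) :
    outsideIdeal K F 1 ∈ (chainOutsideIdeal K P r 1).minimalPrimes := by
  refine ⟨⟨isPrime_outsideIdeal F, chainOutsideIdeal_le 1 hF.1⟩, fun q hq hqF => ?_⟩
  refine outsideIdeal_one_le_iff.2 fun i hi => ?_
  obtain ⟨j, hj, hjq⟩ := exists_X_mem_of_not_isChainColorable hq.1 hq.2
    (S := insert i F) fun h => hi (hF.2 h (Finset.subset_insert i F) (Finset.mem_insert_self i F))
  rcases Finset.mem_insert.1 hj with rfl | hjF
  · exact hjq
  · exact absurd hjF (X_mem_outsideIdeal.1 (hqF hjq))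

theorem exists_maximal_of_mem_minimalPrimes {r : ℕ} {p : Ideal (MvPolynomial P K)}
    (hp : p ∈ (chainOutsideIdeal K P r 1).minimalPrimes) :
    ∃ F : Finset P, Maximal (IsChainColorable r) F ∧ p = outsideIdeal K F 1 := by
  classical
  let F : Finset P := {i | X i ∉ p}
  have hF : IsChainColorable r F := by
    by_contra h
    obtain ⟨i, hi, hip⟩ := exists_X_mem_of_not_isChainColorable hp.1.1 hp.1.2 h
    simp [F, hip] at hi
  have hFp : outsideIdeal K F 1 ≤ p := outsideIdeal_one_le_iff.2 fun i hi => by simpa [F] using hi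
  have hle : ∀ G, IsChainColorable r G → F ⊆ G → p ≤ outsideIdeal K G 1 := fun G hG hFG =>
    hp.2 ⟨isPrime_outsideIdeal G, chainOutsideIdeal_le 1 hG⟩ ((outsideIdeal_anti hFG 1).trans hFp)
  refine ⟨F, ⟨hF, fun G hG hFG i hi => ?_⟩, le_antisymm (hle F hF subset_rfl) hFp⟩
  by_contra hiF
  exact X_mem_outsideIdeal.1 (hle G hG hFG (by simpa [F] using hiF)) hi

theorem symbolicPower_chainOutsideIdeal (r s : ℕ) :
    symbolicPower (chainOutsideIdeal K P r 1) s = chainOutsideIdeal K P r s := by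
  apply le_antisymm
  · intro f hf
    obtain ⟨w, hw, hwf⟩ := mem_symbolicPower.1 hf
    refine mem_chainOutsideIdeal.2 fun F hF => ?_
    obtain ⟨G, hFG, hG⟩ := (Set.toFinite {G : Finset P | IsChainColorable r G}).exists_le_maximal hF
    refine outsideIdeal_anti hFG s (mem_outsideIdeal_of_mul_mem ?_
      (hw _ (mem_minimalPrimes_of_maximal hG)))
    exact pow_le_outsideIdeal (chainOutsideIdeal_le 1 hG.1) s hwf
  · intro f hf
    refine mem_of_monomial_mem fun m hm => mem_symbolicPower_of_forall_minimalPrimes fun p hp => ?_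
    obtain ⟨F, hF, rfl⟩ := exists_maximal_of_mem_minimalPrimes hp
    have hms := mem_chainOutsideIdeal_iff_support.1 hf m hm F hF.1
    -- One copy of `m_F` for each factor `x_i` with `i ∉ F`: the product `m_F x_i` lies in the ideal
    -- by maximality of `F`, while `m_F` avoids the prime of `F`.
    refine ⟨squarefreeMonomial K F ^ (∑ i ∈ Fᶜ, m i), fun h => ?_, ?_⟩
    · have := squarefreeMonomial_mem_outsideIdeal.1 ((isPrime_outsideIdeal F).mem_of_pow_mem _ h)
      simp at this
    · refine Ideal.pow_le_pow_right hms ?_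
      rw [monomial_eq, C_1, one_mul, Finsupp.prod_fintype _ _ (by simp),
        ← Finset.prod_compl_mul_prod F, ← mul_assoc, ← Finset.prod_pow_eq_pow_sum,
        ← Finset.prod_pow_eq_pow_sum, ← Finset.prod_mul_distrib]
      refine Ideal.mul_mem_right _ _ (Ideal.prod_mem_prod fun i hi => ?_)
      rw [← mul_pow, mul_comm, squarefreeMonomial,
        ← Finset.prod_insert (f := fun i => (X i : MvPolynomial P K)) (Finset.mem_compl.1 hi)]
      refine Ideal.pow_mem_pow (squarefreeMonomial_mem_chainOutsideIdeal_one fun h => ?_) _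
      exact Finset.mem_compl.1 hi (hF.2 h (Finset.subset_insert i F) (Finset.mem_insert_self i F))

end

/-! ### Products of antichains and differential perfection -/

/-- The ideal generated by the products of antichains of size greater than `r` whose excesses
over `r` add up to `s`. -/
noncomputable def antichainProductIdeal (K : Type*) [Field K] (P : Type*) [PartialOrder P]
    (r s : ℕ) : Ideal (MvPolynomial P K) :=
  Ideal.span {f : MvPolynomial P K | ∃ (l : ℕ) (A : Fin l → Finset P),
          (∀ i, IsAntichain (· ≤ ·) (A i : Set P)) ∧
          (∀ i, r + 1 ≤ (A i).card) ∧
          ∑ i, ((A i).card - r) = s ∧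
          f = ∏ i, squarefreeMonomial K (A i)}

section

variable {K : Type*} [Field K] {P : Type*} [PartialOrder P] {r : ℕ}

theorem antichainProductIdeal_zero : antichainProductIdeal K P r 0 = ⊤ :=
  (Ideal.eq_top_iff_one _).2 <| Ideal.subset_span
    ⟨0, Fin.elim0, fun i => i.elim0, fun i => i.elim0, by simp, by simp⟩

theorem antichainProductIdeal_mul_le (s t : ℕ) :
    antichainProductIdeal K P r s * antichainProductIdeal K P r t
      ≤ antichainProductIdeal K P r (s + t) := by
  rw [antichainProductIdeal, antichainProductIdeal, Ideal.span_mul_span, Ideal.span_le]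
  rintro _ ⟨_, ⟨l, A, hA1, hA2, hA3, rfl⟩, _, ⟨l', B, hB1, hB2, hB3, rfl⟩, rfl⟩
  refine Ideal.subset_span ⟨l + l', Fin.append A B, ?_, ?_, ?_, ?_⟩
  · exact Fin.addCases (by simpa using hA1) (by simpa using hB1)
  · exact Fin.addCases (by simpa using hA2) (by simpa using hB2)
  · simp [Fin.sum_univ_add, hA3, hB3]
  · simp [Fin.prod_univ_add]

theorem squarefreeMonomial_mem_antichainProductIdeal {A : Finset P}
    (hA : IsAntichain (· ≤ ·) (A : Set P)) {c : ℕ} (hc : c ≤ A.card - r) :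
    squarefreeMonomial K A ∈ antichainProductIdeal K P r c := by
  rcases Nat.eq_zero_or_pos c with rfl | hpos
  · simp [antichainProductIdeal_zero]
  -- Generators need total excess exactly `s`, so the antichain is cut down to `r + c` points.
  obtain ⟨B, hBA, hB⟩ := Finset.exists_subset_card_eq (show r + c ≤ A.card by omega)
  refine Ideal.mem_of_dvd _ (Finset.prod_dvd_prod_of_subset B A _ hBA) ?_
  exact Ideal.subset_span ⟨1, fun _ => B, fun _ => hA.subset (by exact_mod_cast hBA),
    fun _ => show r + 1 ≤ B.card by omega, by simp [hB], by simp [squarefreeMonomial]⟩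

theorem prod_squarefreeMonomial_mem_antichainProductIdeal {ι : Type*} (T : Finset ι)
    (A : ι → Finset P) (hA : ∀ t ∈ T, IsAntichain (· ≤ ·) (A t : Set P)) {s : ℕ}
    (hs : s ≤ ∑ t ∈ T, ((A t).card - r)) :
    ∏ t ∈ T, squarefreeMonomial K (A t) ∈ antichainProductIdeal K P r s := by
  classical
  induction T using Finset.induction_on generalizing s with
  | empty =>
    obtain rfl : s = 0 := by simpa using hs
    simp [antichainProductIdeal_zero]
  | insert t T ht ih =>
    rw [Finset.sum_insert ht] at hs
    rw [Finset.prod_insert ht, show s = min s ((A t).card - r) + (s - min s ((A t).card - r)) by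
      omega]
    refine antichainProductIdeal_mul_le _ _ (Ideal.mul_mem_mul ?_ ?_)
    · exact squarefreeMonomial_mem_antichainProductIdeal (hA t (by simp)) (min_le_right _ _)
    · exact ih (fun t' ht' => hA t' (Finset.mem_insert_of_mem ht')) (by omega)

variable [Fintype P] [DecidableEq P]

theorem squarefreeMonomial_mem_chainOutsideIdeal {A : Finset P}
    (hA : IsAntichain (· ≤ ·) (A : Set P)) :
    squarefreeMonomial K A ∈ chainOutsideIdeal K P r (A.card - r) := by
  refine mem_chainOutsideIdeal.2 fun F hF => squarefreeMonomial_mem_outsideIdeal.2 ?_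
  have h1 := hF.card_inter_le hA
  have h2 := Finset.card_sdiff_add_card_inter A F
  omega

theorem prod_squarefreeMonomial_mem_chainOutsideIdeal {ι : Type*} (T : Finset ι)
    (A : ι → Finset P) (hA : ∀ t, IsAntichain (· ≤ ·) (A t : Set P)) :
    ∏ t ∈ T, squarefreeMonomial K (A t) ∈
      chainOutsideIdeal K P r (∑ t ∈ T, ((A t).card - r)) := by
  classical
  induction T using Finset.induction_on with
  | empty => exact mem_chainOutsideIdeal.2 fun F _ => by simp [outsideIdeal_zero]
  | insert t T ht ih =>
    rw [Finset.prod_insert ht, Finset.sum_insert ht]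
    exact mul_mem_chainOutsideIdeal (squarefreeMonomial_mem_chainOutsideIdeal (hA t)) ih

theorem chainOutsideIdeal_eq_antichainProductIdeal (hr : 1 ≤ r) (s : ℕ) :
    chainOutsideIdeal K P r s = antichainProductIdeal K P r s := by
  apply le_antisymm
  · intro f hf
    refine mem_of_monomial_mem fun m hm => ?_
    obtain ⟨T, A, hA, hm, hs⟩ := exists_antichains_of_le_weight hr m
      (mem_chainOutsideIdeal_iff_support.1 hf m hm)
    refine Ideal.mem_of_dvd _ ?_ (prod_squarefreeMonomial_mem_antichainProductIdeal T A hA hs)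
    -- The exponent of `x_i` counts the antichains through `i`, which is at most `m i`.
    have : ∏ t ∈ T, squarefreeMonomial K (A t)
        = ∏ i, (X i : MvPolynomial P K) ^ (T.filter fun t => i ∈ A t).card := by
      simp only [squarefreeMonomial, ← Finset.prod_const]
      exact Finset.prod_comm' (by simp [and_comm])
    rw [this, monomial_eq, C_1, one_mul, Finsupp.prod_fintype _ _ (by simp)]
    exact Finset.prod_dvd_prod_of_dvd _ _ fun i _ => pow_dvd_pow _ (hm i)
  · rw [antichainProductIdeal, Ideal.span_le]
    rintro _ ⟨l, A, hA, -, rfl, rfl⟩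
    exact prod_squarefreeMonomial_mem_chainOutsideIdeal Finset.univ A hA

/-- If `F` misses weight below `s`, at most `s - 1` points of the support lie outside `F`; as
singleton chains they complete `F` to a cover by `r + s - 1` chains. -/
theorem chainOutsideIdeal_add_le {s : ℕ} (hs : 1 ≤ s) :
    chainOutsideIdeal K P (r + s - 1) 1 ≤ chainOutsideIdeal K P r s := by
  intro f hf
  rw [mem_chainOutsideIdeal_iff_support]
  intro m hm F hF
  by_contra! hlt
  refine mem_chainOutsideIdeal_one.1 hf m hm (((hF.union
    (isChainColorable_card (m.support \ F))).mono_left ?_).mono fun i hi => by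
      rw [Finset.union_sdiff_self_eq_union]
      exact Finset.mem_union_right _ hi)
  have : (m.support \ F).card ≤ ∑ i ∈ Fᶜ, m i := by
    rw [Finset.card_eq_sum_ones]
    refine (Finset.sum_le_sum fun i hi => ?_).trans (Finset.sum_le_sum_of_subset
      (f := m) fun i hi => Finset.mem_compl.2 (Finset.mem_sdiff.1 hi).2)
    exact Nat.one_le_iff_ne_zero.2 (Finsupp.mem_support_iff.1 (Finset.mem_sdiff.1 hi).1)
  omega

theorem chainOutsideIdeal_eq_add_sum (hr : 1 ≤ r) {s : ℕ} (hs : 1 ≤ s) :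
    chainOutsideIdeal K P r s = chainOutsideIdeal K P (r + s - 1) 1 +
      ∑ i ∈ Finset.Ico 1 s, chainOutsideIdeal K P r i * chainOutsideIdeal K P r (s - i) := by
  rw [Ideal.add_eq_sup, Ideal.sum_eq_sup]
  apply le_antisymm
  · rw [chainOutsideIdeal_eq_antichainProductIdeal hr, antichainProductIdeal, Ideal.span_le]
    rintro _ ⟨l, A, hA, hcard, hsum, rfl⟩
    -- The empty product is excluded by `1 ≤ s`. With at least two antichains, the first and the
    -- rest both have positive excess, so the first excess lies in `Ico 1 s`.
    rcases l with _ | _ | l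
    · simp at hsum
      omega
    · refine Ideal.mem_sup_left ?_
      rw [Fin.prod_univ_one]
      rw [Fin.sum_univ_one] at hsum
      refine squarefreeMonomial_mem_chainOutsideIdeal_one fun h => ?_
      have := h.card_inter_le (hA 0)
      rw [Finset.inter_self] at this
      omega
    · refine Ideal.mem_sup_right ?_
      rw [Fin.prod_univ_succ]
      rw [Fin.sum_univ_succ] at hsum
      have h1 : ∑ i : Fin (l + 1), ((A i.succ).card - r) = s - ((A 0).card - r) := by omega
      have h2 : 1 ≤ ∑ i : Fin (l + 1), ((A i.succ).card - r) := by
        rw [Fin.sum_univ_succ]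
        have := hcard (Fin.succ 0)
        omega
      have h0 := hcard 0
      refine (Finset.le_sup (f := fun i => chainOutsideIdeal K P r i *
        chainOutsideIdeal K P r (s - i)) (b := (A 0).card - r)
        (Finset.mem_Ico.2 ⟨by omega, by omega⟩)) ?_
      refine Ideal.mul_mem_mul (squarefreeMonomial_mem_chainOutsideIdeal (hA 0)) ?_
      rw [← h1]
      exact prod_squarefreeMonomial_mem_chainOutsideIdeal Finset.univ
        (fun i : Fin (l + 1) => A i.succ) fun i => hA i.succ
  · refine sup_le (chainOutsideIdeal_add_le hs) (Finset.sup_le fun i hi => ?_)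
    rw [Finset.mem_Ico] at hi
    refine Ideal.mul_le.2 fun f hf g hg => ?_
    have := mul_mem_chainOutsideIdeal hf hg
    rwa [Nat.add_sub_cancel' hi.2.le] at this

end

theorem mainTheorem3 (K : Type*) [Field K] (P : Type*) [PartialOrder P] [Finite P] :
    IsDifferentiallyPerfect (antichainIdeal K P) ∧
    ∀ r s : ℕ, 1 ≤ r → 1 ≤ s →
      symbolicPower (secantIdeal (antichainIdeal K P) r) s =
        Ideal.span {f : MvPolynomial P K | ∃ (l : ℕ) (A : Fin l → Finset P),
          (∀ i, IsAntichain (· ≤ ·) (A i : Set P)) ∧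
          (∀ i, r + 1 ≤ (A i).card) ∧
          ∑ i, ((A i).card - r) = s ∧
          f = ∏ i, squarefreeMonomial K (A i)} := by
  classical
  have := Fintype.ofFinite P
  refine ⟨fun r hr s hs => ?_, fun r s hr _ => ?_⟩
  · simp only [secantIdeal_antichainIdeal hr, symbolicPower_chainOutsideIdeal]
    rw [secantIdeal_antichainIdeal (by omega)]
    exact chainOutsideIdeal_eq_add_sum hr hs
  · rw [secantIdeal_antichainIdeal hr, symbolicPower_chainOutsideIdeal]
    exact chainOutsideIdeal_eq_antichainProductIdeal hr s
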